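/- Let $X$ be a compact metric space with a dense sequence of points $(s_j)_{j\in\mathbb N}$ (a computable compact metric space), let $f:X\to X$ be continuous, and let $\mathcal M$ be the set of $f$-invariant Borel probability measures on $X$ with the weak$^*$ topology. Let $h_\mu(f)\in[0,\infty]$ denote the measure-theoretic entropy, and assume that $\mu\mapsto h_\mu(f)$ is upper semi-continuous on $\mathcal M$. For $\Phi\in C(X,\mathbb R^m)$ put $$\mathrm{rv}_\Phi(\mu)=\Big(\int\Phi_1\,d\mu,\dots,\int\Phi_m\,d\mu\Big),\qquad \mathrm{Rot}(\Phi)=\{\mathrm{rv}_\Phi(\mu):\mu\in\mathcal M\},$$ $$\mathcal H_\Phi(w)=\sup\{h_\mu(f):\mu\in\mathcal M,\ \mathrm{rv}_\Phi(\mu)=w\}\quad (w\in\mathrm{Rot}(\Phi)),$$ and, for $w_0\in\mathbb R^m$ and $\rho>0$, $$h^u_\Phi(w_0,\rho)=\sup_{w\in\overline B(w_0,\rho)\cap \mathrm{Rot}(\Phi)}\mathcal H_\Phi(w),\qquad h^l_\Phi(w_0,\rho)=\inf_{w\in\overline B(w_0,\rho)\cap \mathrm{Rot}(\Phi)}\mathcal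 H_\Phi(w),$$ with $\sup\emptyset=+\infty$ and $\inf\emptyset=-\infty$. An oracle for a point $x$ of a metric space with a fixed dense sequence $(t_j)_j$ is a function $\varphi:\mathbb N\to\mathbb N$ with $d(x,t_{\varphi(n)})<2^{-n}$ for all $n$; the point is computable (computable relative to $A:\mathbb N\to\mathbb N$) if it has an oracle that is computed by a Turing machine (by a Turing machine with access to $A$). In $\mathbb R$ and $\mathbb R^m$ the dense sequence is a standard enumeration of the rational points. A sequence $(x_n)_n$ of points is computable if a single Turing machine computes $(n,k)\mapsto\psi(n,k)$ such that each $\psi(n,\cdot)$ is an oracle for $x_n$. A map is computable if a single oracle Turing machine transforms every oracle for $x$ into an oracle for its value at $x$. Let $\Phi:X\to\mathbb R^m$ be continuous and computable, let $w_0\in\mathrm{int}\,\mathrm{Rot}(\Phi)$, and let $r>0$ be a computable real number with $B(w_0,r)\subset\mathrm{int}\,\mathrm{Rot}(\Phi)$. Let $(\Phi_{\epsilon_n})_n$ in $C(X,\mathbb R^m)$ be an approximating sequence of $\Phi$, that is, $\epsilon_n\to0$ and $\|\Phi_{\epsilon_n}-\Phi\|_\infty<\epsilon_n$ for all $n$,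 and let the sequence $(\epsilon_n)_n$ be computable. Let $A:\mathbb N\to\mathbb N$ be an oracle with the help of which the functions $(n,s)\mapsto h^l_{\Phi_{\epsilon_n}}(w_0,2^{-s})$ and $(n,s)\mapsto h^u_{\Phi_{\epsilon_n}}(w_0,2^{-s})$ can be approximated to arbitrary precision: for each of the two functions there is a Turing machine which, given access to $A$ and to an arbitrary oracle for a real number $s$, outputs on input $(n,k)$ a rational number at distance less than $2^{-k}$ from the value of the function at $(n,s)$ (in particular, this value is finite), for all $n,k\in\mathbb N$ and all $s\in\mathbb R$ with $\overline B(w_0,2^{-s})\cap\mathrm{Rot}(\Phi_{\epsilon_n})\neq\emptyset$. Then $\mathcal H_\Phi(w_0)$ is a finite real number that is computable relative to $A$. In particular, if $A$ is computable (that is, if the two functions are computable where the ball meets the rotation set), then $\mathcal H_\Phi(w_0)$ is computable. -/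

import Mathlib

open MeasureTheory Filter Topology
open scoped ENNReal

/-! ### Computability over metric spaces -/

/-- A computable metric space: a metric space together with a dense sequence of points
(the ideal points). Repetitions in the sequence are allowed, so finite spaces are included. -/
structure IdealPoints (X : Type*) [MetricSpace X] where
  pt : ℕ → X
  dense : DenseRange pt

/-- The standard enumeration of the rationals: `(a - b) / (c + 1)`, with `a, b, c` decoded from
the index. -/
def ratEnum (j : ℕ) : ℚ :=
  (((Nat.unpair (Nat.unpair j).1).1 : ℚ) - ((Nat.unpair (Nat.unpair j).1).2 : ℚ)) /
    ((Nat.unpair j).2 + 1)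

theorem ratEnum_surjective : Function.Surjective ratEnum := by
  intro q
  refine ⟨Nat.pair (Nat.pair q.num.toNat (-q.num).toNat) (q.den - 1), ?_⟩
  have hd : ((q.den - 1 : ℕ) : ℚ) + 1 = q.den := by
    have h : q.den - 1 + 1 = q.den := Nat.sub_add_cancel q.pos
    exact_mod_cast h
  have hn : ((q.num.toNat : ℕ) : ℚ) - (((-q.num).toNat : ℕ) : ℚ) = q.num := by
    have h : ((q.num.toNat : ℕ) : ℤ) - (((-q.num).toNat : ℕ) : ℤ) = q.num := by omega
    exact_mod_cast h
  simp only [ratEnum, Nat.unpair_pair]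
  rw [hd, hn, Rat.num_div_den]

/-- The enumeration of the points of `ℚ^m`: the index codes a list of naturals, whose entries are
the indices of the coordinates. -/
def ratVecEnum (m : ℕ) (j : ℕ) : Fin m → ℚ :=
  fun i => ratEnum ((Denumerable.ofNat (List ℕ) j).getD i 0)

theorem ratVecEnum_surjective (m : ℕ) : Function.Surjective (ratVecEnum m) := by
  intro v
  choose g hg using fun i => ratEnum_surjective (v i)
  refine ⟨Encodable.encode (List.ofFn g), ?_⟩
  funext i
  simp [ratVecEnum, hg]

/-- `ℝ` with its rational points. -/
def realPoints : IdealPoints ℝ where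
  pt j := (ratEnum j : ℝ)
  dense := Rat.denseRange_cast.comp ratEnum_surjective.denseRange Rat.continuous_coe_real

/-- `ℝ^m`, with the Euclidean metric, and its rational points. -/
def euclideanPoints (m : ℕ) : IdealPoints (EuclideanSpace ℝ (Fin m)) where
  pt j := WithLp.toLp 2 fun i => (ratVecEnum m j i : ℝ)
  dense := by
    have h1 : DenseRange fun (v : Fin m → ℚ) (i : Fin m) => (v i : ℝ) :=
      DenseRange.piMap fun _ => Rat.denseRange_cast
    have h2 : Continuous fun (v : Fin m → ℚ) (i : Fin m) => (v i : ℝ) :=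
      continuous_pi fun i => Rat.continuous_coe_real.comp (continuous_apply i)
    have h3 : DenseRange fun j (i : Fin m) => (ratVecEnum m j i : ℝ) :=
      h1.comp (ratVecEnum_surjective m).denseRange h2
    exact (WithLp.toLp_surjective 2).denseRange.comp h3 (PiLp.continuous_toLp 2 _)

/-- `φ` is an oracle for the point `x`: on input `n` it gives the index of an ideal point at
distance less than `2⁻ⁿ` from `x`. -/
def IsOracleFor {X : Type*} [MetricSpace X] (S : IdealPoints X) (x : X) (φ : ℕ → ℕ) : Prop :=
  ∀ n, dist x (S.pt (φ n)) < (2 : ℝ)⁻¹ ^ n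

/-- A computable point: some Turing machine is an oracle for it. -/
def IsComputablePoint {X : Type*} [MetricSpace X] (S : IdealPoints X) (x : X) : Prop :=
  ∃ φ : ℕ → ℕ, Computable φ ∧ IsOracleFor S x φ

/-- A point that is computable relative to `A`: some Turing machine with access to `A` is an
oracle for it. -/
def IsComputablePointIn {X : Type*} [MetricSpace X] (A : ℕ → ℕ) (S : IdealPoints X) (x : X) :
    Prop :=
  ∃ φ : ℕ → ℕ, ComputableIn {fun n => Part.some (A n)} φ ∧ IsOracleFor S x φ

/-- A computable sequence of points: one Turing machine approximates all terms. -/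
def IsComputableSeq {X : Type*} [MetricSpace X] (S : IdealPoints X) (x : ℕ → X) : Prop :=
  ∃ ψ : ℕ → ℕ → ℕ, Computable₂ ψ ∧ ∀ n, IsOracleFor S (x n) (ψ n)

/-- Programs of oracle machines, presented as partial recursive schemes with one additional
instruction that queries the oracle. -/
inductive OracleCode : Type
  | zero : OracleCode
  | succ : OracleCode
  | left : OracleCode
  | right : OracleCode
  | query : OracleCode
  | pair : OracleCode → OracleCode → OracleCode
  | comp : OracleCode → OracleCode → OracleCode
  | prec : OracleCode → OracleCode → OracleCode
  | rfind : OracleCode → OracleCode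

/-- The partial function computed by a program with oracle `φ`; the clauses are those of
`Nat.RecursiveIn {φ}`. -/
def OracleCode.eval (φ : ℕ → ℕ) : OracleCode → ℕ →. ℕ
  | .zero => fun _ => Part.some 0
  | .succ => fun n => Part.some (n + 1)
  | .left => fun n => Part.some (Nat.unpair n).1
  | .right => fun n => Part.some (Nat.unpair n).2
  | .query => fun n => Part.some (φ n)
  | .pair a b => fun n => Nat.pair <$> a.eval φ n <*> b.eval φ n
  | .comp a b => fun n => b.eval φ n >>= a.eval φ
  | .prec a b => fun p =>
      (Nat.unpair p).2.rec (a.eval φ (Nat.unpair p).1) fun y IH => do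
        let i ← IH
        b.eval φ (Nat.pair (Nat.unpair p).1 (Nat.pair y i))
  | .rfind a => fun p =>
      Nat.rfind fun n => (fun m => decide (m = 0)) <$> a.eval φ (Nat.pair p n)

/-- A computable function between computable metric spaces: one oracle machine turns every
oracle for `x` into an oracle for `g x`. -/
def IsComputableMap {X Y : Type*} [MetricSpace X] [MetricSpace Y]
    (S : IdealPoints X) (T : IdealPoints Y) (g : X → Y) : Prop :=
  ∃ c : OracleCode, ∀ (x : X) (φ : ℕ → ℕ), IsOracleFor S x φ →
    ∀ n, ∃ j ∈ c.eval φ n, dist (g x) (T.pt j) < (2 : ℝ)⁻¹ ^ n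

/-- Two oracles combined into one: `A` on even numbers, `φ` on odd numbers. -/
def oracleJoin (A φ : ℕ → ℕ) (n : ℕ) : ℕ :=
  bif n.bodd then φ n.div2 else A n.div2

/-- With the help of the oracle `A`, the extended-real-valued function `g` can be approximated
to arbitrary precision at all `(n, s)` in `D`: one machine with access to `A` and to an
arbitrary oracle `φ` for the real number `s` produces, on input `(n, k)`, a rational number at
distance less than `2⁻ᵏ` from `g n s` (which therefore is finite). -/
def IsApproximableIn (A : ℕ → ℕ) (D : ℕ → ℝ → Prop) (g : ℕ → ℝ → EReal) : Prop :=
  ∃ c : OracleCode, ∀ (n : ℕ) (s : ℝ), D n s → ∀ φ : ℕ → ℕ, IsOracleFor realPoints s φ →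
    ∀ k, ∃ j ∈ c.eval (oracleJoin A φ) (Nat.pair n k),
      ∃ y : ℝ, g n s = (y : EReal) ∧ dist y (realPoints.pt j) < (2 : ℝ)⁻¹ ^ k

/-! ### Entropy and rotation sets -/

section Dynamics

variable {X : Type*} [MetricSpace X] [CompactSpace X] [MeasurableSpace X] [BorelSpace X]

/-- The invariant Borel probability measures of `f`, as a subset of the space of probability
measures with the weak topology. -/
def invariantMeasures (f : X → X) : Set (ProbabilityMeasure X) :=
  {μ | MeasurePreserving f (μ : Measure X) (μ : Measure X)}

/-- The Shannon entropy of the `n`-th refinement `⋁_{i<n} f⁻ⁱ P` of the finite partition `P` into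
the level sets of `ξ`. -/
noncomputable def partitionEntropy (f : X → X) (μ : ProbabilityMeasure X) {k : ℕ}
    (ξ : X → Fin k) (n : ℕ) : ℝ :=
  ∑ a : Fin n → Fin k,
    Real.negMulLog ((μ : Measure X).real {x | ∀ i : Fin n, ξ (f^[(i : ℕ)] x) = a i})

/-- The measure-theoretic (Kolmogorov–Sinai) entropy: the supremum, over all finite measurable
partitions, of `lim (1/n) H(⋁_{i<n} f⁻ⁱ P)`. For an invariant measure this limit exists, by
subadditivity, and so equals the `liminf`. -/
noncomputable def measureEntropy (f : X → X) (μ : ProbabilityMeasure X) : ℝ≥0∞ :=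
  ⨆ (k : ℕ) (ξ : X → Fin k) (_ : Measurable ξ),
    liminf (fun n : ℕ => ENNReal.ofReal (partitionEntropy f μ ξ n / n)) atTop

variable {m : ℕ}

/-- The rotation vector `(∫ Φ₁ dμ, …, ∫ Φₘ dμ)`. -/
noncomputable def rotationVector (Φ : C(X, EuclideanSpace ℝ (Fin m)))
    (μ : ProbabilityMeasure X) : EuclideanSpace ℝ (Fin m) :=
  WithLp.toLp 2 fun i => ∫ x, Φ x i ∂(μ : Measure X)

/-- The generalized rotation set. -/
def rotationSet (f : X → X) (Φ : C(X, EuclideanSpace ℝ (Fin m))) :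
    Set (EuclideanSpace ℝ (Fin m)) :=
  rotationVector Φ '' invariantMeasures f

/-- The localized entropy at `w`. -/
noncomputable def localizedEntropy (f : X → X) (Φ : C(X, EuclideanSpace ℝ (Fin m)))
    (w : EuclideanSpace ℝ (Fin m)) : ℝ≥0∞ :=
  ⨆ μ ∈ {μ | μ ∈ invariantMeasures f ∧ rotationVector Φ μ = w}, measureEntropy f μ

open Classical in
/-- The maximum local entropy on the closed ball, with `sup ∅ = +∞`. -/
noncomputable def maxLocalEntropy (f : X → X) (Φ : C(X, EuclideanSpace ℝ (Fin m)))
    (w₀ : EuclideanSpace ℝ (Fin m)) (r : ℝ) : EReal :=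
  if (Metric.closedBall w₀ r ∩ rotationSet f Φ).Nonempty then
    ((⨆ w ∈ Metric.closedBall w₀ r ∩ rotationSet f Φ, localizedEntropy f Φ w : ℝ≥0∞) : EReal)
  else ⊤

open Classical in
/-- The minimum local entropy on the closed ball, with `inf ∅ = -∞`. -/
noncomputable def minLocalEntropy (f : X → X) (Φ : C(X, EuclideanSpace ℝ (Fin m)))
    (w₀ : EuclideanSpace ℝ (Fin m)) (r : ℝ) : EReal :=
  if (Metric.closedBall w₀ r ∩ rotationSet f Φ).Nonempty then
    ((⨅ w ∈ Metric.closedBall w₀ r ∩ rotationSet f Φ, localizedEntropy f Φ w : ℝ≥0∞) : EReal)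
  else ⊥

/-- `(Ψ n)` with errors `(ε n)` is an approximating sequence of `Φ`. -/
def IsApproximatingSeq (Φ : C(X, EuclideanSpace ℝ (Fin m))) (ε : ℕ → ℝ)
    (Ψ : ℕ → C(X, EuclideanSpace ℝ (Fin m))) : Prop :=
  Tendsto ε atTop (𝓝 0) ∧ ∀ n, ‖Ψ n - Φ‖ < ε n

end Dynamics

/-! Entropy is concave under mixtures of measures and the rotation vector is affine, so $\mathcal
H_\Phi$ is concave on $\mathrm{Rot}(\Phi)$ and therefore continuous at the interior point $w_0$. The
proof squeezes $H=\mathcal H_\Phi(w_0)$ between approximable bounds.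

Choose effectively an index $n=N(s)$ with $4\epsilon_n<2^{-s}$, and let $a_s,b_s$ be the minimum and
maximum local entropies of $\Phi_{\epsilon_n}$ on the ball of radius $2^{-s}$. Then $H\le b_s$,
because a measure with $\mathrm{rv}_\Phi=w_0$ has its perturbed rotation vector in that ball. The
bound $a_s\le H$ is less direct: if $a_s>H$, the vectors $\mathrm{rv}_\Phi(\mu)$ with $h_\mu>H$ come
close to every point near $w_0$. By concavity they form a convex set, and a convex set that
approximates a ball contains a slightly smaller ball (`Convex.ball_subset_of_approx`). So $w_0$ is
one of them, which is absurd. Continuity of $\mathcal H_\Phi$ at $w_0$, transferred to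
$\Phi_{\epsilon_n}$ by the same convexity argument, gives $b_s-a_s\to0$.

A machine with oracle $A$ therefore searches for an $s$ at which the approximations of $a_s$ and
$b_s$ are close, and outputs the approximation of $b_s$ (`isComputablePointIn_of_bounds`).
Finiteness comes from the approximability at a large negative exponent, whose ball contains a whole
rotation set. -/

theorem Convex.ball_subset_of_approx {E : Type*} [NormedAddCommGroup E] [InnerProductSpace ℝ E]
    [FiniteDimensional ℝ E] {C : Set E} (hC : Convex ℝ C) {w : E} {ρ a : ℝ} (ha : 0 ≤ a)
    (h : ∀ v ∈ Metric.ball w ρ, ∃ c ∈ C, dist c v ≤ a) : Metric.ball w (ρ - a) ⊆ C := by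
  rcases le_or_gt (ρ - a) 0 with hρ | hρ
  · simp [Metric.ball_eq_empty.2 hρ]
  have hcl : Metric.ball w (ρ - a) ⊆ closure C := by
    intro p hp
    by_contra hpC
    obtain ⟨l, t, hl, ht⟩ :=
      geometric_hahn_banach_point_closed hC.closure isClosed_closure hpC
    set u : E := (InnerProductSpace.toDual ℝ E).symm l with hu
    have hlu : ∀ x, l x = inner ℝ u x := fun x => by simp [hu]
    rcases eq_or_ne u 0 with h0 | h0
    · obtain ⟨c, hc, -⟩ := h w (Metric.mem_ball_self (by linarith))
      have := ht c (subset_closure hc)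
      simp only [hlu, h0, inner_zero_left] at hl this
      linarith
    · have hn : 0 < ‖u‖ := norm_pos_iff.2 h0
      -- Move from `p` a distance `a` away from the side of `C`: a point of `C` within `a` of the
      -- new position has `l`-value at most `l p`, contradicting the separation.
      have hv : p - (a / ‖u‖) • u ∈ Metric.ball w ρ := by
        rw [Metric.mem_ball] at hp ⊢
        calc dist (p - (a / ‖u‖) • u) w
            ≤ dist (p - (a / ‖u‖) • u) p + dist p w := dist_triangle _ _ _
          _ = a + dist p w := by
              congr 1
              rw [dist_eq_norm, sub_sub_cancel_left, norm_neg, norm_smul, Real.norm_eq_abs,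
                abs_of_nonneg (by positivity), div_mul_cancel₀ _ hn.ne']
          _ < ρ := by linarith
      obtain ⟨c, hc, hcd⟩ := h _ hv
      have h1 := ht c (subset_closure hc)
      have h2 : inner ℝ u (c - (p - (a / ‖u‖) • u)) ≤ ‖u‖ * a :=
        (real_inner_le_norm _ _).trans (by rw [dist_eq_norm] at hcd; gcongr)
      have h3 : inner ℝ u (c - (p - (a / ‖u‖) • u)) = l c - l p + ‖u‖ * a := by
        rw [hlu, hlu, inner_sub_right, inner_sub_right, inner_smul_right,
          real_inner_self_eq_norm_sq]
        field_simp
        ring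
      linarith
  -- To pass from the closure to `C` itself, `C` needs interior: affine subspaces are closed in
  -- finite dimension, so the span of `C` already contains the ball.
  have hspan : affineSpan ℝ C = ⊤ := by
    have h1 : Metric.ball w (ρ - a) ⊆ affineSpan ℝ C :=
      hcl.trans (closure_minimal (subset_affineSpan ℝ C)
        (AffineSubspace.closed_of_finiteDimensional _))
    have h2 := Metric.isOpen_ball.affineSpan_eq_top ⟨w, Metric.mem_ball_self hρ⟩
    exact top_le_iff.1 (h2 ▸ affineSpan_le.2 h1)
  have hint : (interior C).Nonempty := hC.interior_nonempty_iff_affineSpan_eq_top.2 hspan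
  exact (interior_maximal hcl Metric.isOpen_ball).trans
    ((hC.interior_closure_eq_interior_of_nonempty_interior hint).subset.trans interior_subset)

/-! ### Concavity of the entropy and stability of rotation vectors -/

section EntropyConcavity

set_option linter.unusedSectionVars false

variable {X : Type*} [MetricSpace X] [CompactSpace X] [MeasurableSpace X] [BorelSpace X]

theorem negMulLog_sum_le {ι : Type*} (s : Finset ι) (p : ι → ℝ) (hp : ∀ i ∈ s, 0 ≤ p i) :
    Real.negMulLog (∑ i ∈ s, p i) ≤ ∑ i ∈ s, Real.negMulLog (p i) := by
  simp only [Real.negMulLog, neg_mul, Finset.sum_neg_distrib, Finset.sum_mul]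
  refine neg_le_neg (Finset.sum_le_sum fun i hi => ?_)
  rcases (hp i hi).eq_or_lt with h | h
  · simp [← h]
  · exact mul_le_mul_of_nonneg_left
      (Real.log_le_log h (Finset.single_le_sum hp hi)) h.le

theorem measurableSet_itinerary {f : X → X} (hf : Measurable f) {k : ℕ} {ξ : X → Fin k}
    (hξ : Measurable ξ) {n : ℕ} (a : Fin n → Fin k) :
    MeasurableSet {x | ∀ i : Fin n, ξ (f^[(i : ℕ)] x) = a i} := by
  rw [Set.ofPred_forall]
  exact MeasurableSet.iInter fun i =>
    (hξ.comp (hf.iterate i)) (measurableSet_singleton (a i))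

/-- Passing to a finer partition does not decrease the entropy. -/
theorem partitionEntropy_comp_le {f : X → X} (hf : Measurable f) (μ : ProbabilityMeasure X)
    {k l : ℕ} {ξ : X → Fin k} (hξ : Measurable ξ) (g : Fin k → Fin l) (n : ℕ) :
    partitionEntropy f μ (g ∘ ξ) n ≤ partitionEntropy f μ ξ n := by
  classical
  unfold partitionEntropy
  rw [← Finset.sum_fiberwise Finset.univ (fun a : Fin n → Fin k => g ∘ a)]
  refine Finset.sum_le_sum fun b _ => ?_
  refine le_trans (le_of_eq ?_) (negMulLog_sum_le _ _ fun _ _ => measureReal_nonneg)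
  congr 1
  rw [← measureReal_biUnion_finset]
  · congr 1
    ext x
    simp only [Function.comp_apply, Set.mem_ofPred_eq, Finset.mem_filter, Finset.mem_univ,
      true_and, Set.mem_iUnion, exists_prop]
    constructor
    · intro h
      exact ⟨fun i => ξ (f^[(i : ℕ)] x), funext h, fun _ => rfl⟩
    · rintro ⟨a, rfl, h⟩ i
      simp [h i]
  · intro a _ a' _ hne
    refine Set.disjoint_left.2 fun x hx hx' => hne (funext fun i => ?_)
    exact (hx i).symm.trans (hx' i)
  · exact fun a _ => measurableSet_itinerary hf hξ a

/-- `κ` is the mixture `a μ + b ν`. -/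
def IsMixture (a b : ℝ) (μ ν κ : ProbabilityMeasure X) : Prop :=
  (κ : Measure X) = ENNReal.ofReal a • (μ : Measure X) + ENNReal.ofReal b • (ν : Measure X)

theorem exists_isMixture {a b : ℝ} (ha : 0 ≤ a) (hb : 0 ≤ b) (hab : a + b = 1)
    (μ ν : ProbabilityMeasure X) : ∃ κ, IsMixture a b μ ν κ := by
  refine ⟨⟨ENNReal.ofReal a • (μ : Measure X) + ENNReal.ofReal b • (ν : Measure X), ⟨?_⟩⟩, rfl⟩
  simp [← ENNReal.ofReal_add ha hb, hab]

namespace IsMixture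

variable {a b : ℝ} {μ ν κ : ProbabilityMeasure X}

theorem real_apply (h : IsMixture a b μ ν κ) (ha : 0 ≤ a) (hb : 0 ≤ b) (s : Set X) :
    (κ : Measure X).real s = a * (μ : Measure X).real s + b * (ν : Measure X).real s := by
  have ht : ∀ (c : ℝ) (μ : ProbabilityMeasure X),
      (ENNReal.ofReal c • (μ : Measure X)) s ≠ ⊤ := fun c μ => by
    rw [Measure.smul_apply, smul_eq_mul]
    exact ENNReal.mul_ne_top ENNReal.ofReal_ne_top (measure_ne_top _ _)
  rw [h, measureReal_add_apply (ht a μ) (ht b ν), measureReal_ennreal_smul_apply, measureReal_ennreal_smul_apply,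
    ENNReal.toReal_ofReal ha, ENNReal.toReal_ofReal hb]

theorem mem_invariantMeasures (h : IsMixture a b μ ν κ) {f : X → X}
    (hμ : μ ∈ invariantMeasures f) (hν : ν ∈ invariantMeasures f) :
    κ ∈ invariantMeasures f := by
  refine ⟨hμ.measurable, ?_⟩
  rw [h, Measure.map_add _ _ hμ.measurable, Measure.map_smul, Measure.map_smul, hμ.map_eq,
    hν.map_eq]

theorem rotationVector_eq (h : IsMixture a b μ ν κ) (ha : 0 ≤ a) (hb : 0 ≤ b) {m : ℕ}
    (Φ : C(X, EuclideanSpace ℝ (Fin m))) :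
    rotationVector Φ κ = a • rotationVector Φ μ + b • rotationVector Φ ν := by
  ext i
  have hc : Continuous fun x => Φ x i := by fun_prop
  have hi : ∀ μ : ProbabilityMeasure X, Integrable (fun x => Φ x i) (μ : Measure X) := fun μ =>
    hc.integrable_of_hasCompactSupport (HasCompactSupport.of_compactSpace _)
  simp only [rotationVector, PiLp.add_apply, PiLp.smul_apply, smul_eq_mul]
  rw [h, integral_add_measure ((hi μ).smul_measure ENNReal.ofReal_ne_top)
    ((hi ν).smul_measure ENNReal.ofReal_ne_top), integral_smul_measure, integral_smul_measure,
    ENNReal.toReal_ofReal ha, ENNReal.toReal_ofReal hb, smul_eq_mul, smul_eq_mul]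

theorem le_partitionEntropy (h : IsMixture a b μ ν κ) (ha : 0 ≤ a) (hb : 0 ≤ b)
    (hab : a + b = 1) (f : X → X) {k : ℕ} (ξ : X → Fin k) (n : ℕ) :
    a * partitionEntropy f μ ξ n + b * partitionEntropy f ν ξ n ≤ partitionEntropy f κ ξ n := by
  simp only [partitionEntropy, Finset.mul_sum, ← Finset.sum_add_distrib, h.real_apply ha hb]
  exact Finset.sum_le_sum fun s _ =>
    Real.concaveOn_negMulLog.2 measureReal_nonneg measureReal_nonneg ha hb hab

end IsMixture

theorem partitionEntropy_nonneg (f : X → X) (μ : ProbabilityMeasure X) {k : ℕ} (ξ : X → Fin k)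
    (n : ℕ) : 0 ≤ partitionEntropy f μ ξ n :=
  Finset.sum_nonneg fun _ _ => Real.negMulLog_nonneg measureReal_nonneg measureReal_le_one

theorem exists_partitionEntropy_of_lt {f : X → X} {μ : ProbabilityMeasure X} {c : ℝ}
    (hμ : measureEntropy f μ ≠ ⊤) (hc : c < (measureEntropy f μ).toReal) :
    ∃ (k : ℕ) (ξ : X → Fin k), Measurable ξ ∧
      ∀ᶠ n : ℕ in atTop, c ≤ partitionEntropy f μ ξ n / n := by
  -- `ENNReal.ofReal` truncates negative `c` to 0, where the strict inequality may fail; the trivial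
  -- partition serves instead.
  rcases lt_or_ge c 0 with h0 | h0
  · exact ⟨1, fun _ => 0, measurable_const, Eventually.of_forall fun n =>
      h0.le.trans (div_nonneg (partitionEntropy_nonneg _ _ _ _) n.cast_nonneg)⟩
  · have h : ENNReal.ofReal c < measureEntropy f μ :=
      (ENNReal.ofReal_lt_iff_lt_toReal h0 hμ).2 hc
    simp only [measureEntropy, lt_iSup_iff, exists_prop] at h
    obtain ⟨k, ξ, hξ, h⟩ := h
    refine ⟨k, ξ, hξ, ?_⟩
    filter_upwards [eventually_lt_of_lt_liminf h (by isBoundedDefault)] with n hn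
    exact (ENNReal.ofReal_le_ofReal_iff
      (div_nonneg (partitionEntropy_nonneg _ _ _ _) n.cast_nonneg)).1 hn.le

/-- The measure-theoretic entropy is a concave function of the measure. -/
theorem IsMixture.le_toReal_measureEntropy {a b : ℝ} {μ ν κ : ProbabilityMeasure X}
    (h : IsMixture a b μ ν κ) (ha : 0 ≤ a) (hb : 0 ≤ b)
    (hab : a + b = 1) {f : X → X} (hf : Measurable f) (hκ : measureEntropy f κ ≠ ⊤)
    (hμ : measureEntropy f μ ≠ ⊤) (hν : measureEntropy f ν ≠ ⊤) :
    a * (measureEntropy f μ).toReal + b * (measureEntropy f ν).toReal ≤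
      (measureEntropy f κ).toReal := by
  refine le_of_forall_pos_le_add fun η hη => ?_
  obtain ⟨k, ξ, hξ, hc⟩ := exists_partitionEntropy_of_lt hμ (sub_lt_self _ hη)
  obtain ⟨l, ζ, hζ, hd⟩ := exists_partitionEntropy_of_lt hν (sub_lt_self _ hη)
  set c := (measureEntropy f μ).toReal with hc_def
  set d := (measureEntropy f ν).toReal with hd_def
  -- The common refinement is nearly optimal for both measures at once, so concavity for a fixed
  -- partition applies to it.
  set χ : X → Fin (k * l) := fun x => finProdFinEquiv (ξ x, ζ x) with hχ
  have hχm : Measurable χ := (measurable_of_finite _).comp (hξ.prodMk hζ)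
  have h1 : (fun i => (finProdFinEquiv.symm i).1) ∘ χ = ξ := by
    funext x
    exact congrArg Prod.fst (finProdFinEquiv.symm_apply_apply (ξ x, ζ x))
  have h2 : (fun i => (finProdFinEquiv.symm i).2) ∘ χ = ζ := by
    funext x
    exact congrArg Prod.snd (finProdFinEquiv.symm_apply_apply (ξ x, ζ x))
  suffices hs : ENNReal.ofReal (a * (c - η) + b * (d - η)) ≤ measureEntropy f κ by
    have := (ENNReal.ofReal_le_iff_le_toReal hκ).1 hs
    linear_combination this + η * hab
  refine le_trans ?_ (le_iSup_of_le (k * l) (le_iSup_of_le χ (le_iSup_of_le hχm le_rfl)))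
  refine le_liminf_of_le (by isBoundedDefault) ?_
  filter_upwards [hc, hd] with n hn hn'
  have e1 := partitionEntropy_comp_le hf μ hχm (fun i => (finProdFinEquiv.symm i).1) n
  have e2 := partitionEntropy_comp_le hf ν hχm (fun i => (finProdFinEquiv.symm i).2) n
  rw [h1] at e1
  rw [h2] at e2
  refine ENNReal.ofReal_le_ofReal ?_
  calc a * (c - η) + b * (d - η)
      ≤ a * (partitionEntropy f μ ξ n / n) + b * (partitionEntropy f ν ζ n / n) := by gcongr
    _ = (a * partitionEntropy f μ ξ n + b * partitionEntropy f ν ζ n) / n := by ring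
    _ ≤ (a * partitionEntropy f μ χ n + b * partitionEntropy f ν χ n) / n := by gcongr
    _ ≤ partitionEntropy f κ χ n / n := by
        gcongr
        exact h.le_partitionEntropy ha hb hab f χ n

/-- Rotation vectors of uniformly close potentials are close. -/
theorem dist_rotationVector_le {m : ℕ} (Φ Ψ : C(X, EuclideanSpace ℝ (Fin m)))
    (μ : ProbabilityMeasure X) :
    dist (rotationVector Φ μ) (rotationVector Ψ μ) ≤ ‖Ψ - Φ‖ := by
  have hi : ∀ Φ : C(X, EuclideanSpace ℝ (Fin m)), Integrable Φ (μ : Measure X) := fun Φ =>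
    Φ.continuous.integrable_of_hasCompactSupport (HasCompactSupport.of_compactSpace _)
  -- As a vector-valued integral, the rotation vector admits the norm bound directly in the
  -- Euclidean norm, with no factor depending on `m`.
  have key : ∀ Φ : C(X, EuclideanSpace ℝ (Fin m)),
      rotationVector Φ μ = ∫ x, Φ x ∂(μ : Measure X) := by
    intro Φ
    ext i
    exact (EuclideanSpace.proj (𝕜 := ℝ) i).integral_comp_comm (hi Φ)
  rw [dist_comm, dist_eq_norm, key, key, ← integral_sub (hi Ψ) (hi Φ)]
  refine (norm_integral_le_of_norm_le_const (C := ‖Ψ - Φ‖)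
    (ae_of_all _ fun x => ?_)).trans (by simp)
  exact (Ψ - Φ).norm_coe_le_norm x

end EntropyConcavity

/-- The function `e` on `M` is concave along the map `R` into a
vector space: `M` contains mixtures, on which `R` is affine and `e` is concave. -/
def IsConcaveAlong {P V : Type*} [AddCommGroup V] [Module ℝ V] (M : Set P) (e : P → ℝ)
    (R : P → V) : Prop :=
  ∀ μ ∈ M, ∀ ν ∈ M, ∀ a b : ℝ, 0 ≤ a → 0 ≤ b → a + b = 1 →
    ∃ κ ∈ M, R κ = a • R μ + b • R ν ∧ a * e μ + b * e ν ≤ e κ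

/-! ### Concave functions along a map: continuity at interior points and perturbation -/

namespace IsConcaveAlong

variable {P V : Type*} [NormedAddCommGroup V] {M : Set P} {e : P → ℝ} {R R' : P → V}

/-- A mixture of two points with `e > c` again has `e > c`. This convexity is what turns approximate
attainment of a vector into exact attainment. -/
theorem convex_image [Module ℝ V] (h : IsConcaveAlong M e R) (c : ℝ) :
    Convex ℝ (R '' {μ | μ ∈ M ∧ c < e μ}) := by
  rintro _ ⟨μ, ⟨hμ, hcμ⟩, rfl⟩ _ ⟨ν, ⟨hν, hcν⟩, rfl⟩ a b ha hb hab
  obtain ⟨κ, hκ, hR, he⟩ := h μ hμ ν hν a b ha hb hab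
  refine ⟨κ, ⟨hκ, lt_of_lt_of_le ?_ he⟩, hR⟩
  exact (convex_Ioi (𝕜 := ℝ) c) hcμ hcν ha hb hab

/-- Near a point in the interior of its domain, a concave function is not much larger
than at that point. -/
theorem exists_forall_le [NormedSpace ℝ V] (h : IsConcaveAlong M e R) (he : ∀ μ ∈ M, 0 ≤ e μ)
    {w : V} {r H : ℝ} (hr : 0 < r) (hball : Metric.ball w r ⊆ R '' M)
    (hH : ∀ μ ∈ M, R μ = w → e μ ≤ H) {η : ℝ} (hη : 0 < η) :
    ∃ ρ > 0, ∀ μ ∈ M, R μ ∈ Metric.ball w ρ → e μ ≤ H + η := by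
  obtain ⟨μ₀, hμ₀, hRμ₀⟩ := hball (Metric.mem_ball_self hr)
  have hH0 : 0 ≤ H := (he μ₀ hμ₀).trans (hH μ₀ hμ₀ hRμ₀)
  -- Chosen so that `t * (H + η) ≤ η`, that is, `H ≤ (1 - t) * (H + η)`.
  set t : ℝ := η / (H + η + 1) with ht
  have ht0 : 0 < t := by positivity
  have ht1 : t < 1 := by rw [ht, div_lt_one (by positivity)]; linarith
  refine ⟨t * r, by positivity, fun μ hμ hRμ => ?_⟩
  -- The point beyond `w`, seen from `R μ`, for which `w` is the mixture with weights `1 - t` and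
  -- `t`; concavity at `w` then gives `(1 - t) * e μ ≤ H`.
  obtain ⟨κ, hκ, hRκ⟩ := hball (show w - ((1 - t) / t) • (R μ - w) ∈ Metric.ball w r by
    rw [Metric.mem_ball, dist_eq_norm] at hRμ ⊢
    rw [sub_sub_cancel_left, norm_neg, norm_smul, Real.norm_eq_abs,
      abs_of_nonneg (div_nonneg (by linarith) ht0.le), div_mul_eq_mul_div, div_lt_iff₀ ht0]
    nlinarith [norm_nonneg (R μ - w)])
  obtain ⟨ν, hν, hRν, heν⟩ := h μ hμ κ hκ (1 - t) t (by linarith) ht0.le (by ring)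
  have hw : R ν = w := by
    rw [hRν, hRκ, smul_sub, smul_smul, mul_div_cancel₀ _ ht0.ne']
    module
  have h1 := hH ν hν hw
  have h2 : (H + η + 1) * t = η := by rw [ht]; field_simp
  have h3 := mul_nonneg ht0.le (he κ hκ)
  have h4 : (1 - t) * e μ ≤ (1 - t) * (H + η) := by nlinarith
  exact le_of_mul_le_mul_left h4 (by linarith)

/-- Near a point in the interior of its domain, a concave function is not much smaller
than at that point. -/
theorem exists_forall_exists_lt [NormedSpace ℝ V] (h : IsConcaveAlong M e R)
    (he : ∀ μ ∈ M, 0 ≤ e μ) {w : V} {r c : ℝ} (hr : 0 < r) (hball : Metric.ball w r ⊆ R '' M)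
    {μ : P} (hμ : μ ∈ M) (hRμ : R μ = w) (hc : c < e μ) :
    ∃ ρ > 0, ∀ v ∈ Metric.ball w ρ, ∃ ν ∈ M, R ν = v ∧ c < e ν := by
  have h0 := he μ hμ
  obtain ⟨t, ht0, ht1, htc⟩ : ∃ t : ℝ, 0 < t ∧ t ≤ 1 ∧ t * e μ < e μ - c := by
    refine ⟨min 1 ((e μ - c) / (e μ + 1)), ?_, min_le_left _ _, ?_⟩
    · have : 0 < e μ - c := by linarith
      positivity
    · have h1 : min 1 ((e μ - c) / (e μ + 1)) * e μ ≤ (e μ - c) / (e μ + 1) * e μ :=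
        mul_le_mul_of_nonneg_right (min_le_right _ _) h0
      refine h1.trans_lt ?_
      rw [div_mul_eq_mul_div, div_lt_iff₀ (by linarith)]
      nlinarith
  refine ⟨t * r, by positivity, fun v hv => ?_⟩
  -- Now `v` is the mixture of `w` and this farther point. Since `e κ ≥ 0`, at most `t * e μ < e μ -
  -- c` is lost.
  obtain ⟨κ, hκ, hRκ⟩ := hball (show w + t⁻¹ • (v - w) ∈ Metric.ball w r by
    rw [Metric.mem_ball, dist_eq_norm] at hv ⊢
    rw [add_sub_cancel_left, norm_smul, Real.norm_eq_abs, abs_of_pos (inv_pos.2 ht0),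
      inv_mul_lt_iff₀ ht0]
    exact hv)
  obtain ⟨ν, hν, hRν, heν⟩ := h μ hμ κ hκ (1 - t) t (by linarith) ht0.le (by ring)
  refine ⟨ν, hν, ?_, ?_⟩
  · rw [hRν, hRκ, hRμ, smul_add, smul_smul, mul_inv_cancel₀ ht0.ne']
    module
  · nlinarith [mul_nonneg ht0.le (he κ hκ)]

/-- If the values of `R` in a ball around `w` are attained at points with `e > c`, then so are
the values in a smaller ball of a perturbation of `R`. -/
theorem exists_lt_of_perturbation {V : Type*} [NormedAddCommGroup V] [InnerProductSpace ℝ V]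
    [FiniteDimensional ℝ V] {R : P → V} (h : IsConcaveAlong M e R) {w : V} {ρ a c : ℝ}
    (ha : 0 ≤ a) (hR : ∀ v ∈ Metric.ball w ρ, ∃ μ ∈ M, dist (R μ) v ≤ a ∧ c < e μ) {v : V}
    (hv : v ∈ Metric.ball w (ρ - a)) : ∃ μ ∈ M, R μ = v ∧ c < e μ := by
  obtain ⟨μ, ⟨hμ, hc⟩, rfl⟩ := (h.convex_image c).ball_subset_of_approx ha
    (fun v hv => by
      obtain ⟨μ, hμ, hd, hc⟩ := hR v hv
      exact ⟨R μ, ⟨μ, ⟨hμ, hc⟩, rfl⟩, hd⟩) hv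
  exact ⟨μ, hμ, rfl, hc⟩

end IsConcaveAlong

/-! ### Relative computability and comparison of rationals -/

section OracleComputability

theorem Nat.RecursiveIn.of_computable {O : Set (ℕ →. ℕ)} {g : ℕ → ℕ} (hg : Computable g) :
    Nat.RecursiveIn O g :=
  Nat.Partrec.recursiveIn (Partrec.nat_iff.1 hg)

theorem Nat.RecursiveIn.comp_total {O : Set (ℕ →. ℕ)} {g : ℕ →. ℕ} {h : ℕ → ℕ}
    (hg : Nat.RecursiveIn O g) (hh : Nat.RecursiveIn O h) :
    Nat.RecursiveIn O fun n => g (h n) :=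
  (hg.comp hh).of_eq fun _ => Part.bind_some _ _

theorem Nat.RecursiveIn.pair_total {O : Set (ℕ →. ℕ)} {g h : ℕ → ℕ}
    (hg : Nat.RecursiveIn O g) (hh : Nat.RecursiveIn O h) :
    Nat.RecursiveIn O (fun n => Nat.pair (g n) (h n) : ℕ → ℕ) :=
  (hg.pair hh).of_eq fun n => by simp [Seq.seq]

/-- Running a program on an oracle that is itself computed, from a parameter, with the help of
`O`, is computable in `O`, uniformly in the parameter. -/
theorem OracleCode.recursiveIn_eval {O : Set (ℕ →. ℕ)} {φ : ℕ → ℕ → ℕ}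
    (hφ : Nat.RecursiveIn O (fun p => φ p.unpair.1 p.unpair.2 : ℕ → ℕ)) (c : OracleCode) :
    Nat.RecursiveIn O fun p => c.eval (φ p.unpair.1) p.unpair.2 := by
  have hl : Nat.RecursiveIn O (fun p => p.unpair.1 : ℕ → ℕ) := .left
  have hr : Nat.RecursiveIn O (fun p => p.unpair.2 : ℕ → ℕ) := .right
  induction c with
  | zero => exact Nat.RecursiveIn.zero
  | succ => exact Nat.RecursiveIn.succ.comp_total hr
  | left => exact hl.comp_total hr
  | right => exact hr.comp_total hr
  | query => exact hφ
  | pair a b iha ihb => exact iha.pair ihb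
  | comp a b iha ihb =>
    refine (iha.comp (hl.pair ihb)).of_eq fun p => ?_
    have e : (Nat.pair <$> ((fun p => p.unpair.1 : ℕ → ℕ) : ℕ →. ℕ) p <*>
        b.eval (φ p.unpair.1) p.unpair.2) =
        (b.eval (φ p.unpair.1) p.unpair.2).map (Nat.pair p.unpair.1) := by
      simp [Seq.seq]
    rw [e, Part.bind_eq_bind, Part.bind_map]
    simp only [Nat.unpair_pair]
    rfl
  | prec a b iha ihb =>
    have hll := hl.comp_total hl
    have hlr := hr.comp_total hl
    -- The recursion keeps the oracle parameter and the original argument together as its fixed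
    -- part; the input of `b` is reassociated accordingly.
    have hb := ihb.comp_total (hll.pair_total (hlr.pair_total hr))
    have hrl : Nat.RecursiveIn O (fun p => p.unpair.2.unpair.1 : ℕ → ℕ) := hl.comp_total hr
    have hrr : Nat.RecursiveIn O (fun p => p.unpair.2.unpair.2 : ℕ → ℕ) := hr.comp_total hr
    refine ((iha.prec hb).comp_total ((hl.pair_total hrl).pair_total hrr)).of_eq fun p => ?_
    simp [OracleCode.eval]
  | rfind a iha =>
    have ha := iha.comp_total ((hl.comp_total hl).pair_total ((hr.comp_total hl).pair_total hr))
    refine ha.rfind.of_eq fun p => ?_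
    simp [OracleCode.eval]

theorem ComputableIn.computable_of_oracle {A : ℕ → ℕ} {g : ℕ → ℕ}
    (hg : ComputableIn {fun n => Part.some (A n)} g) (hA : Computable A) : Computable g :=
  RecursiveIn.partrec_of_oracle (fun h hh => by rw [Set.mem_singleton_iff.1 hh]; exact hA.partrec) hg

/-- An index of the natural number `s` among the rationals. -/
def natIndex (s : ℕ) : ℕ := Nat.pair (Nat.pair s 0) 0

theorem ratEnum_natIndex (s : ℕ) : ratEnum (natIndex s) = s := by
  simp [ratEnum, natIndex]

theorem isOracleFor_natIndex (s : ℕ) : IsOracleFor realPoints (s : ℝ) fun _ => natIndex s := by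
  intro n
  simp [realPoints, ratEnum_natIndex]

/-- Clearing denominators and moving subtracted terms across leaves a strict inequality between
polynomial expressions in naturals and `2 ^ k`. -/
theorem primrecPred_ratEnum_sub_lt :
    PrimrecPred fun p : (ℕ × ℕ) × ℕ => (ratEnum p.1.1 : ℝ) - ratEnum p.1.2 < (2 : ℝ)⁻¹ ^ p.2 := by
  have hun : ∀ {g : (ℕ × ℕ) × ℕ → ℕ}, Primrec g →
      Primrec (fun p => (g p).unpair.1) ∧ Primrec (fun p => (g p).unpair.2) := fun hg =>
    ⟨Primrec.fst.comp (Primrec.unpair.comp hg), Primrec.snd.comp (Primrec.unpair.comp hg)⟩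
  have hi : Primrec fun p : (ℕ × ℕ) × ℕ => p.1.1 := Primrec.fst.comp Primrec.fst
  have hj : Primrec fun p : (ℕ × ℕ) × ℕ => p.1.2 := Primrec.snd.comp Primrec.fst
  have ha := (hun (hun hi).1).1
  have hb := (hun (hun hi).1).2
  have hc := Primrec.succ.comp (hun hi).2
  have ha' := (hun (hun hj).1).1
  have hb' := (hun (hun hj).1).2
  have hc' := Primrec.succ.comp (hun hj).2
  have hpow : Primrec fun p : (ℕ × ℕ) × ℕ => 2 ^ p.2 :=
    (Primrec₂.unpaired'.1 Nat.Primrec.pow).comp (Primrec.const 2) Primrec.snd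
  have hlt := Primrec.nat_lt.comp
    (Primrec.nat_mul.comp hpow (Primrec.nat_add.comp
      (Primrec.nat_mul.comp ha hc') (Primrec.nat_mul.comp hb' hc)))
    (Primrec.nat_add.comp (Primrec.nat_mul.comp hc hc')
      (Primrec.nat_mul.comp hpow (Primrec.nat_add.comp
        (Primrec.nat_mul.comp hb hc') (Primrec.nat_mul.comp ha' hc))))
  refine hlt.of_eq fun p => ?_
  obtain ⟨⟨i, j⟩, k⟩ := p
  simp only [ratEnum]
  generalize i.unpair.1.unpair.1 = a
  generalize i.unpair.1.unpair.2 = b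
  generalize i.unpair.2 = c
  generalize j.unpair.1.unpair.1 = a'
  generalize j.unpair.1.unpair.2 = b'
  generalize j.unpair.2 = c'
  push_cast
  rw [inv_pow, div_sub_div _ _ (by positivity) (by positivity), div_lt_iff₀ (by positivity),
    inv_mul_eq_div, lt_div_iff₀ (by positivity), ← Nat.cast_lt (α := ℝ)]
  push_cast
  constructor <;> intro h <;> linarith

end OracleComputability

/-! ### Effective search and computation of a squeezed limit -/

section EffectiveLimits

theorem Nat.RecursiveIn.exists_rfind {O : Set (ℕ →. ℕ)} {t : ℕ → ℕ → ℕ}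
    (ht : Nat.RecursiveIn O (fun p => t p.unpair.1 p.unpair.2 : ℕ → ℕ))
    (h : ∀ k, ∃ s, t k s = 0) :
    ∃ S : ℕ → ℕ, Nat.RecursiveIn O S ∧ ∀ k, t k (S k) = 0 := by
  have hdom : ∀ k, ∃ s, s ∈ Nat.rfind fun s => (fun m => decide (m = 0)) <$>
      ((fun p => t p.unpair.1 p.unpair.2 : ℕ → ℕ) : ℕ →. ℕ) (Nat.pair k s) := fun k => by
    refine Part.dom_iff_mem.1 (Nat.rfind_dom.2 ?_)
    obtain ⟨s, hs⟩ := h k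
    exact ⟨s, by simp [hs], fun _ => trivial⟩
  choose S hS using hdom
  refine ⟨S, ht.rfind.of_eq_tot hS, fun k => ?_⟩
  simpa [eq_comm] using Nat.rfind_spec (hS k)

theorem exists_primrec_ratEnum_sub_lt : ∃ T : ℕ → ℕ, Nat.Primrec T ∧ ∀ i j k,
    T (Nat.pair (Nat.pair i j) k) = 0 ↔ (ratEnum i : ℝ) - ratEnum j < (2 : ℝ)⁻¹ ^ k := by
  have h1 : Primrec fun p : ℕ => (p.unpair.1.unpair, p.unpair.2) :=
    (Primrec.unpair.comp (Primrec.fst.comp Primrec.unpair)).pair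
      (Primrec.snd.comp Primrec.unpair)
  obtain ⟨hd, h2⟩ := primrecPred_ratEnum_sub_lt
  -- Once the predicate is opaque, `decide` uses the instance `hd`, the one for which recursiveness
  -- is known.
  generalize hP : (fun p : (ℕ × ℕ) × ℕ =>
    (ratEnum p.1.1 : ℝ) - ratEnum p.1.2 < (2 : ℝ)⁻¹ ^ p.2) = P at hd h2
  refine ⟨fun p => bif decide (P (p.unpair.1.unpair, p.unpair.2)) then 0 else 1,
    Primrec.nat_iff.1 (Primrec.cond (h2.comp h1) (Primrec.const 0) (Primrec.const 1)),
    fun i j k => ?_⟩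
  have h3 : ((ratEnum i : ℝ) - ratEnum j < (2 : ℝ)⁻¹ ^ k) = P ((i, j), k) := by rw [← hP]
  rw [h3]
  by_cases h : P ((i, j), k) <;> simp [h]

/-- A real number between two sequences whose difference is arbitrarily small, and which can be
approximated with the help of `A`, is computable relative to `A`. -/
theorem isComputablePointIn_of_bounds {A : ℕ → ℕ} {H : ℝ} {U L : ℕ → ℕ}
    (hU : Nat.RecursiveIn {fun n => Part.some (A n)} U)
    (hL : Nat.RecursiveIn {fun n => Part.some (A n)} L) {a b : ℕ → ℝ}
    (hUb : ∀ s k, dist (b s) (realPoints.pt (U (Nat.pair s k))) < (2 : ℝ)⁻¹ ^ k)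
    (hLa : ∀ s k, dist (a s) (realPoints.pt (L (Nat.pair s k))) < (2 : ℝ)⁻¹ ^ k)
    {s₀ : ℕ} (hab : ∀ s, s₀ ≤ s → a s ≤ H ∧ H ≤ b s)
    (hlim : ∀ η > 0, ∃ s, s₀ ≤ s ∧ b s - a s < η) : IsComputablePointIn A realPoints H := by
  obtain ⟨T, hT, hT0⟩ := exists_primrec_ratEnum_sub_lt
  have hp : ∀ n, (0 : ℝ) < 2⁻¹ ^ n := fun n => by positivity
  have hq : Computable fun p : ℕ => Nat.pair (p.unpair.2 + s₀) (p.unpair.1 + 3) :=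
    (Primrec₂.natPair.comp
      (Primrec.nat_add.comp (Primrec.snd.comp Primrec.unpair) (Primrec.const s₀))
      (Primrec.nat_add.comp (Primrec.fst.comp Primrec.unpair) (Primrec.const 3))).to_comp
  have hk : Computable fun p : ℕ => p.unpair.1 + 1 :=
    (Primrec.succ.comp (Primrec.fst.comp Primrec.unpair)).to_comp
  -- Errors are below `2⁻¹ ^ (k + 3)` and the search accepts a gap below `2⁻¹ ^ (k + 1)`. A true gap
  -- below `2⁻¹ ^ (k + 2)` is accepted, and acceptance puts the output within `5/8 * 2⁻¹ ^ k` of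
  -- `H`.
  set Q : ℕ → ℕ → ℕ := fun k s => Nat.pair (s + s₀) (k + 3) with hQ
  have hUQ : Nat.RecursiveIn {fun n => Part.some (A n)}
      (fun p => U (Q p.unpair.1 p.unpair.2) : ℕ → ℕ) :=
    hU.comp_total (.of_computable hq)
  have hLQ : Nat.RecursiveIn {fun n => Part.some (A n)}
      (fun p => L (Q p.unpair.1 p.unpair.2) : ℕ → ℕ) :=
    hL.comp_total (.of_computable hq)
  have hTQ : Nat.RecursiveIn {fun n => Part.some (A n)}
      (fun p => T (Nat.pair (Nat.pair (U (Q p.unpair.1 p.unpair.2))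
        (L (Q p.unpair.1 p.unpair.2))) (p.unpair.1 + 1)) : ℕ → ℕ) :=
    hT.recursiveIn.comp_total ((hUQ.pair_total hLQ).pair_total (.of_computable hk))
  obtain ⟨S, hS, hS0⟩ := Nat.RecursiveIn.exists_rfind
    (t := fun k s => T (Nat.pair (Nat.pair (U (Q k s)) (L (Q k s))) (k + 1))) hTQ fun k => by
      obtain ⟨s, hs, hsη⟩ := hlim (2⁻¹ ^ (k + 2)) (hp _)
      refine ⟨s - s₀, (hT0 _ _ _).2 ?_⟩
      simp only [hQ, Nat.sub_add_cancel hs]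
      have h1 := abs_lt.1 (hUb s (k + 3))
      have h2 := abs_lt.1 (hLa s (k + 3))
      have h3 := hp k
      simp only [realPoints] at h1 h2
      rw [pow_succ] at hsη h1 h2 ⊢
      rw [pow_succ] at hsη h1 h2
      rw [pow_succ] at h1 h2
      linarith [h1.1, h2.2]
  refine ⟨fun k => U (Q k (S k)), RecursiveIn.iff_nat.2 ?_, fun k => ?_⟩
  · have h1 : Nat.RecursiveIn {fun n => Part.some (A n)} (fun k => k : ℕ → ℕ) :=
      .of_computable Computable.id
    refine (hUQ.comp_total (h1.pair_total hS)).of_eq fun k => ?_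
    simp
  · have h0 := (hT0 _ _ _).1 (hS0 k)
    have h1 := abs_lt.1 (hUb (S k + s₀) (k + 3))
    have h2 := abs_lt.1 (hLa (S k + s₀) (k + 3))
    have h3 := hp k
    obtain ⟨h4, h5⟩ := hab (S k + s₀) (by omega)
    rw [Real.dist_eq, abs_lt]
    simp only [realPoints, hQ] at h0 h1 h2 ⊢
    rw [pow_succ] at h0 h1 h2
    rw [pow_succ, pow_succ] at h1 h2
    constructor <;> linarith [h1.1, h1.2, h2.1, h2.2]

/-- From a computable sequence that tends to zero, terms below `2⁻ˢ` can be found effectively. -/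
theorem IsComputableSeq.exists_computable_lt {ε : ℕ → ℝ} (hε : IsComputableSeq realPoints ε)
    (hlim : Tendsto ε atTop (𝓝 0)) :
    ∃ N : ℕ → ℕ, Computable N ∧ ∀ s, ε (N s) < (2 : ℝ)⁻¹ ^ s := by
  obtain ⟨T, hT, hT0⟩ := exists_primrec_ratEnum_sub_lt
  obtain ⟨ψ, hψ, hψε⟩ := hε
  have hp : ∀ n, (0 : ℝ) < 2⁻¹ ^ n := fun n => by positivity
  have hr0 : ratEnum 0 = 0 := by simp [ratEnum]
  have hs : Computable fun p : ℕ => p.unpair.1 :=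
    (Primrec.fst.comp Primrec.unpair).to_comp
  have hn : Computable fun p : ℕ => p.unpair.2 :=
    (Primrec.snd.comp Primrec.unpair).to_comp
  have ht : Computable fun p : ℕ =>
      T (Nat.pair (Nat.pair (ψ p.unpair.2 (p.unpair.1 + 2)) 0) (p.unpair.1 + 1)) :=
    (Primrec.nat_iff.2 hT).to_comp.comp (Primrec₂.natPair.to_comp.comp
      (Primrec₂.natPair.to_comp.comp
        (hψ.comp hn (Computable.succ.comp (Computable.succ.comp hs))) (Computable.const 0))
      (Computable.succ.comp hs))
  -- With precision `s + 2` and threshold `2⁻¹ ^ (s + 1)`, any term below `2⁻¹ ^ (s + 2)` is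
  -- accepted and every accepted term is below `2⁻¹ ^ s`.
  obtain ⟨N, hN, hN0⟩ := Nat.RecursiveIn.exists_rfind (O := ∅)
    (t := fun s n => T (Nat.pair (Nat.pair (ψ n (s + 2)) 0) (s + 1)))
    (.of_computable ht) fun s => by
      obtain ⟨n, hn⟩ := (hlim.eventually (gt_mem_nhds (hp (s + 2)))).exists
      refine ⟨n, (hT0 _ _ _).2 ?_⟩
      have h1 := abs_lt.1 (hψε n (s + 2))
      simp only [realPoints] at h1
      rw [hr0, Rat.cast_zero, sub_zero]
      rw [pow_succ] at h1 hn
      linarith [h1.1]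
  refine ⟨N, recursiveIn_empty_iff.1 (RecursiveIn.iff_nat.2 hN), fun s => ?_⟩
  have h0 := (hT0 _ _ _).1 (hN0 s)
  have h1 := abs_lt.1 (hψε (N s) (s + 2))
  have h2 := hp s
  simp only [realPoints] at h1
  rw [hr0, Rat.cast_zero, sub_zero] at h0
  rw [pow_succ] at h0 h1
  rw [pow_succ] at h1
  linarith [h1.2]

/-- A natural number has a constant oracle, so at natural exponents the joined oracle is computable
from `A`, uniformly in the exponent. `A` is queried whatever the parity, and a computable selection
follows. -/
theorem recursiveIn_oracleJoin (A : ℕ → ℕ) :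
    Nat.RecursiveIn {fun n => Part.some (A n)}
      (fun p => oracleJoin A (fun _ => natIndex p.unpair.1) p.unpair.2 : ℕ → ℕ) := by
  have hA : Nat.RecursiveIn {fun n => Part.some (A n)} A := .oracle _ rfl
  have hid : Nat.RecursiveIn {fun n => Part.some (A n)} (fun p => p : ℕ → ℕ) :=
    .of_computable Computable.id
  have hdiv : Computable fun p : ℕ => p.unpair.2.div2 :=
    (Primrec.nat_div2.comp (Primrec.snd.comp Primrec.unpair)).to_comp
  have hF : Computable fun q : ℕ => bif q.unpair.1.unpair.2.bodd
      then natIndex q.unpair.1.unpair.1 else q.unpair.2 := by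
    have hu : Primrec fun q : ℕ => q.unpair.1.unpair :=
      Primrec.unpair.comp (Primrec.fst.comp Primrec.unpair)
    exact (Primrec.cond (Primrec.nat_bodd.comp (Primrec.snd.comp hu))
      (Primrec₂.natPair.comp (Primrec₂.natPair.comp (Primrec.fst.comp hu) (Primrec.const 0))
        (Primrec.const 0)) (Primrec.snd.comp Primrec.unpair)).to_comp
  have h1 : Nat.RecursiveIn {fun n => Part.some (A n)} (fun p => A p.unpair.2.div2 : ℕ → ℕ) :=
    hA.comp_total (.of_computable hdiv)
  refine ((Nat.RecursiveIn.of_computable hF).comp_total (hid.pair_total h1)).of_eq fun p => ?_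
  simp [oracleJoin]

/-- Values at natural numbers of a function that can be approximated with the help of `A`. -/
theorem IsApproximableIn.exists_index {A : ℕ → ℕ} {D : ℕ → ℝ → Prop} {g : ℕ → ℝ → EReal}
    (hg : IsApproximableIn A D g) {N : ℕ → ℕ} (hN : Computable N) (hD : ∀ s : ℕ, D (N s) s) :
    ∃ (U : ℕ → ℕ) (y : ℕ → ℝ), Nat.RecursiveIn {fun n => Part.some (A n)} U ∧
      (∀ s : ℕ, g (N s) s = y s) ∧
      ∀ s k, dist (y s) (realPoints.pt (U (Nat.pair s k))) < (2 : ℝ)⁻¹ ^ k := by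
  obtain ⟨c, hc⟩ := hg
  have hc' := fun s : ℕ => hc (N s) s (hD s) _ (isOracleFor_natIndex s)
  choose j hj y hy hjy using hc'
  -- The witness was chosen separately for each precision, but it is always the same value of `g`.
  have hyy : ∀ s k, y s k = y s 0 := fun s k =>
    EReal.coe_injective ((hy s k).symm.trans (hy s 0))
  have hq : Computable fun p : ℕ => Nat.pair p.unpair.1 (Nat.pair (N p.unpair.1) p.unpair.2) := by
    have hs : Computable fun p : ℕ => p.unpair.1 := (Primrec.fst.comp Primrec.unpair).to_comp
    have hk : Computable fun p : ℕ => p.unpair.2 := (Primrec.snd.comp Primrec.unpair).to_comp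
    exact Primrec₂.natPair.to_comp.comp hs (Primrec₂.natPair.to_comp.comp (hN.comp hs) hk)
  refine ⟨fun p => j p.unpair.1 p.unpair.2, fun s => y s 0, ?_, fun s => hy s 0, fun s k => ?_⟩
  · refine ((OracleCode.recursiveIn_eval
      (φ := fun s => oracleJoin A fun _ => natIndex s) (recursiveIn_oracleJoin A) c).comp_total
      (.of_computable hq)).of_eq_tot fun p => ?_
    simpa using hj p.unpair.1 p.unpair.2
  · simpa [hyy] using hjy s k

end EffectiveLimits

/-! ### From extremal local entropies to individual measures -/

section LocalizedEntropy

set_option linter.unusedSectionVars false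

variable {X : Type*} [MetricSpace X] [CompactSpace X] [MeasurableSpace X] [BorelSpace X]
  {f : X → X} {m : ℕ} {Ψ : C(X, EuclideanSpace ℝ (Fin m))} {w : EuclideanSpace ℝ (Fin m)}
  {δ y : ℝ}

theorem eq_ofReal_of_coe_eq_coe {S : ℝ≥0∞} {y : ℝ} (h : (S : EReal) = y) :
    0 ≤ y ∧ S = ENNReal.ofReal y := by
  induction S with
  | top => simp at h
  | coe S =>
    have h' : (S : ℝ) = y :=
      EReal.coe_injective ((EReal.coe_nnreal_eq_coe_real S).symm.trans h)
    subst h'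
    exact ⟨S.2, by simp⟩

theorem isConcaveAlong_rotationVector (hf : Measurable f)
    (hfin : ∀ μ ∈ invariantMeasures f, measureEntropy f μ ≠ ⊤)
    (Ψ : C(X, EuclideanSpace ℝ (Fin m))) :
    IsConcaveAlong (invariantMeasures f) (fun μ => (measureEntropy f μ).toReal)
      (rotationVector Ψ) := by
  intro μ hμ ν hν a b ha hb hab
  obtain ⟨κ, hκ⟩ := exists_isMixture ha hb hab μ ν
  have hκM := hκ.mem_invariantMeasures hμ hν
  exact ⟨κ, hκM, hκ.rotationVector_eq ha hb Ψ,
    hκ.le_toReal_measureEntropy ha hb hab hf (hfin κ hκM) (hfin μ hμ) (hfin ν hν)⟩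

theorem measureEntropy_le_of_maxLocalEntropy
    (hne : (Metric.closedBall w δ ∩ rotationSet f Ψ).Nonempty)
    (hy : maxLocalEntropy f Ψ w δ = (y : EReal)) {μ : ProbabilityMeasure X}
    (hμ : μ ∈ invariantMeasures f) (hμw : rotationVector Ψ μ ∈ Metric.closedBall w δ) :
    measureEntropy f μ ≤ ENNReal.ofReal y := by
  rw [maxLocalEntropy, if_pos hne] at hy
  rw [← (eq_ofReal_of_coe_eq_coe hy).2]
  exact le_iSup₂_of_le (rotationVector Ψ μ) ⟨hμw, μ, hμ, rfl⟩
    (le_iSup₂_of_le (f := fun μ _ => measureEntropy f μ) μ ⟨hμ, rfl⟩ le_rfl)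

theorem le_of_maxLocalEntropy (hfin : ∀ μ ∈ invariantMeasures f, measureEntropy f μ ≠ ⊤)
    (hne : (Metric.closedBall w δ ∩ rotationSet f Ψ).Nonempty)
    (hy : maxLocalEntropy f Ψ w δ = (y : EReal)) {c : ℝ}
    (hc : ∀ μ ∈ invariantMeasures f, rotationVector Ψ μ ∈ Metric.closedBall w δ →
      (measureEntropy f μ).toReal ≤ c) : y ≤ c := by
  have hc0 : 0 ≤ c := by
    obtain ⟨_, hv, μ, hμ, rfl⟩ := hne
    exact ENNReal.toReal_nonneg.trans (hc μ hμ hv)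
  rw [maxLocalEntropy, if_pos hne] at hy
  rw [← ENNReal.ofReal_le_ofReal_iff hc0, ← (eq_ofReal_of_coe_eq_coe hy).2]
  refine iSup₂_le fun v hv => iSup₂_le ?_
  rintro μ ⟨hμ, rfl⟩
  exact (ENNReal.le_ofReal_iff_toReal_le (hfin μ hμ) hc0).2 (hc μ hμ hv.1)

/-- The strict inequality `c < y` yields a measure even if the supremum defining the localized
entropy is not attained. -/
theorem exists_lt_measureEntropy_of_minLocalEntropy
    (hfin : ∀ μ ∈ invariantMeasures f, measureEntropy f μ ≠ ⊤)
    (hne : (Metric.closedBall w δ ∩ rotationSet f Ψ).Nonempty)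
    (hy : minLocalEntropy f Ψ w δ = (y : EReal)) {c : ℝ} (hc : c < y)
    {v : EuclideanSpace ℝ (Fin m)} (hv : v ∈ Metric.closedBall w δ ∩ rotationSet f Ψ) :
    ∃ μ ∈ invariantMeasures f, rotationVector Ψ μ = v ∧ c < (measureEntropy f μ).toReal := by
  rcases lt_or_ge c 0 with h0 | h0
  · obtain ⟨-, μ, hμ, rfl⟩ := hv
    exact ⟨μ, hμ, rfl, h0.trans_le ENNReal.toReal_nonneg⟩
  · rw [minLocalEntropy, if_pos hne] at hy
    have h1 : ENNReal.ofReal c < localizedEntropy f Ψ v :=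
      ((ENNReal.ofReal_lt_ofReal_iff (h0.trans_lt hc)).2 hc).trans_le
        ((eq_ofReal_of_coe_eq_coe hy).2.symm.le.trans (iInf₂_le v hv))
    simp only [localizedEntropy, lt_iSup_iff] at h1
    obtain ⟨μ, ⟨hμ, hμv⟩, h1⟩ := h1
    exact ⟨μ, hμ, hμv, (ENNReal.ofReal_lt_iff_lt_toReal h0 (hfin μ hμ)).1 h1⟩

theorem le_of_minLocalEntropy
    (hne : (Metric.closedBall w δ ∩ rotationSet f Ψ).Nonempty)
    (hy : minLocalEntropy f Ψ w δ = (y : EReal)) {c : ℝ}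
    (hc : ∀ v ∈ Metric.closedBall w δ,
      ∃ μ ∈ invariantMeasures f, rotationVector Ψ μ = v ∧ c < (measureEntropy f μ).toReal) :
    c ≤ y := by
  rw [minLocalEntropy, if_pos hne] at hy
  obtain ⟨hy0, hy⟩ := eq_ofReal_of_coe_eq_coe hy
  rw [← ENNReal.ofReal_le_ofReal_iff hy0, ← hy]
  refine le_iInf₂ fun v hv => ?_
  obtain ⟨μ, hμ, hμv, hcμ⟩ := hc v hv.1
  exact le_iSup₂_of_le (f := fun μ _ => measureEntropy f μ) μ ⟨hμ, hμv⟩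
    (ENNReal.ofReal_le_of_le_toReal hcμ.le)

/-- The rotation vectors of all measures lie in a common ball. -/
theorem exists_nat_rotationVector_mem_closedBall (Ψ : C(X, EuclideanSpace ℝ (Fin m)))
    (w : EuclideanSpace ℝ (Fin m)) :
    ∃ k : ℕ, ∀ μ : ProbabilityMeasure X, rotationVector Ψ μ ∈ Metric.closedBall w (2 ^ k) := by
  obtain ⟨k, hk⟩ := pow_unbounded_of_one_lt (‖Ψ - 0‖ + dist 0 w) (one_lt_two (α := ℝ))
  refine ⟨k, fun μ => ?_⟩
  have h0 : rotationVector (0 : C(X, EuclideanSpace ℝ (Fin m))) μ = 0 := by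
    ext i
    simp [rotationVector]
  have h1 := dist_rotationVector_le 0 Ψ μ
  rw [h0, dist_comm] at h1
  exact (dist_triangle _ _ _).trans ((add_le_add_left h1 _).trans hk.le)

theorem exists_isOracleFor_rat (q : ℚ) : ∃ φ, IsOracleFor realPoints (q : ℝ) φ := by
  obtain ⟨j, hj⟩ := ratEnum_surjective q
  exact ⟨fun _ => j, fun n => by simp [realPoints, hj]⟩

end LocalizedEntropy

/-! ### The main theorem -/

theorem mainTheorem9 {X : Type*} [MetricSpace X] [CompactSpace X] [MeasurableSpace X]
    [BorelSpace X] (S : IdealPoints X) (f : X → X) (hf : Continuous f)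
    (husc : UpperSemicontinuousOn (measureEntropy f) (invariantMeasures f))
    {m : ℕ} (Φ : C(X, EuclideanSpace ℝ (Fin m)))
    (hΦ : IsComputableMap S (euclideanPoints m) Φ)
    (w₀ : EuclideanSpace ℝ (Fin m)) (hw₀ : w₀ ∈ interior (rotationSet f Φ))
    (r : ℝ) (hr : 0 < r) (hrc : IsComputablePoint realPoints r)
    (hball : Metric.ball w₀ r ⊆ interior (rotationSet f Φ))
    (ε : ℕ → ℝ) (Ψ : ℕ → C(X, EuclideanSpace ℝ (Fin m)))
    (happrox : IsApproximatingSeq Φ ε Ψ) (hε : IsComputableSeq realPoints ε)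
    (A : ℕ → ℕ)
    (hl : IsApproximableIn A
      (fun n s => (Metric.closedBall w₀ ((2 : ℝ) ^ (-s)) ∩ rotationSet f (Ψ n)).Nonempty)
      (fun n s => minLocalEntropy f (Ψ n) w₀ ((2 : ℝ) ^ (-s))))
    (hu : IsApproximableIn A
      (fun n s => (Metric.closedBall w₀ ((2 : ℝ) ^ (-s)) ∩ rotationSet f (Ψ n)).Nonempty)
      (fun n s => maxLocalEntropy f (Ψ n) w₀ ((2 : ℝ) ^ (-s)))) :
    localizedEntropy f Φ w₀ ≠ ⊤ ∧
      IsComputablePointIn A realPoints (localizedEntropy f Φ w₀).toReal ∧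
      (Computable A → IsComputablePoint realPoints (localizedEntropy f Φ w₀).toReal) := by
  obtain ⟨hε0, hεΨ⟩ := happrox
  have hεpos : ∀ n, 0 < ε n := fun n => (norm_nonneg _).trans_lt (hεΨ n)
  have hdist : ∀ n μ, dist (rotationVector Φ μ) (rotationVector (Ψ n) μ) ≤ ε n := fun n μ =>
    (dist_rotationVector_le Φ (Ψ n) μ).trans (hεΨ n).le
  have hball' : Metric.ball w₀ r ⊆ rotationVector Φ '' invariantMeasures f :=
    hball.trans interior_subset
  obtain ⟨μ₀, hμ₀, hμ₀w⟩ := interior_subset hw₀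
  -- the entropy is bounded
  obtain ⟨y₀, hy₀⟩ : ∃ y : ℝ, ∀ μ ∈ invariantMeasures f,
      measureEntropy f μ ≤ ENNReal.ofReal y := by
    obtain ⟨k, hk⟩ := exists_nat_rotationVector_mem_closedBall (Ψ 0) w₀
    -- At exponent `-k` the radius is `2 ^ k` and the ball contains all rotation vectors of `Ψ 0`;
    -- the finite maximum there bounds the entropy of every invariant measure.
    obtain ⟨φ, hφ⟩ := exists_isOracleFor_rat (-k : ℚ)
    have h2 : (2 : ℝ) ^ (-((-k : ℚ) : ℝ)) = 2 ^ k := by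
      push_cast
      rw [neg_neg, Real.rpow_natCast]
    have hne : (Metric.closedBall w₀ ((2 : ℝ) ^ (-((-k : ℚ) : ℝ))) ∩
        rotationSet f (Ψ 0)).Nonempty :=
      ⟨rotationVector (Ψ 0) μ₀, h2 ▸ hk μ₀, μ₀, hμ₀, rfl⟩
    obtain ⟨c, hc⟩ := hu
    obtain ⟨_, -, y, hy, -⟩ := hc 0 _ hne φ hφ 0
    exact ⟨y, fun μ hμ => measureEntropy_le_of_maxLocalEntropy hne hy hμ (h2 ▸ hk μ)⟩
  have hfin : ∀ μ ∈ invariantMeasures f, measureEntropy f μ ≠ ⊤ := fun μ hμ =>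
    ne_top_of_le_ne_top ENNReal.ofReal_ne_top (hy₀ μ hμ)
  have htop : localizedEntropy f Φ w₀ ≠ ⊤ :=
    ne_top_of_le_ne_top ENNReal.ofReal_ne_top (iSup₂_le fun μ hμ => hy₀ μ hμ.1)
  have hconc := isConcaveAlong_rotationVector (m := m) hf.measurable hfin
  have he0 : ∀ μ ∈ invariantMeasures f, 0 ≤ (measureEntropy f μ).toReal := fun _ _ =>
    ENNReal.toReal_nonneg
  set H := (localizedEntropy f Φ w₀).toReal with hH_def
  have hH : ∀ μ ∈ invariantMeasures f, rotationVector Φ μ = w₀ →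
      (measureEntropy f μ).toReal ≤ H := fun μ hμ hμw =>
    ENNReal.toReal_mono htop
      (le_iSup₂_of_le (f := fun μ _ => measureEntropy f μ) μ ⟨hμ, hμw⟩ le_rfl)
  have hH' : ∀ c < H, ∃ μ ∈ invariantMeasures f, rotationVector Φ μ = w₀ ∧
      c < (measureEntropy f μ).toReal := fun c hc => by
    rcases lt_or_ge c 0 with h0 | h0
    · exact ⟨μ₀, hμ₀, hμ₀w, h0.trans_le ENNReal.toReal_nonneg⟩
    · have h1 := (ENNReal.ofReal_lt_iff_lt_toReal h0 htop).2 hc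
      simp only [localizedEntropy, lt_iSup_iff] at h1
      obtain ⟨μ, ⟨hμ, hμv⟩, h1⟩ := h1
      exact ⟨μ, hμ, hμv, (ENNReal.ofReal_lt_iff_lt_toReal h0 (hfin μ hμ)).1 h1⟩
  -- radii and indices
  obtain ⟨N', hN', hN'ε⟩ := hε.exists_computable_lt hε0
  set N : ℕ → ℕ := fun s => N' (s + 2) with hN_def
  have hN : Computable N :=
    hN'.comp (Computable.succ.comp Computable.succ)
  have hrad : ∀ s : ℕ, (2 : ℝ) ^ (-(s : ℝ)) = 2⁻¹ ^ s := fun s => by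
    rw [Real.rpow_neg zero_le_two, Real.rpow_natCast, inv_pow]
  have hNε : ∀ s, 4 * ε (N s) < 2⁻¹ ^ s := fun s => by
    have := hN'ε (s + 2)
    rw [pow_succ, pow_succ] at this
    simp only [hN_def]
    linarith
  have hne : ∀ s : ℕ, (Metric.closedBall w₀ ((2 : ℝ) ^ (-(s : ℝ))) ∩
      rotationSet f (Ψ (N s))).Nonempty := fun s => by
    refine ⟨rotationVector (Ψ (N s)) μ₀, ?_, μ₀, hμ₀, rfl⟩
    have h1 := hdist (N s) μ₀
    rw [hμ₀w, dist_comm] at h1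
    rw [Metric.mem_closedBall, hrad]
    linarith [hNε s, hεpos (N s)]
  obtain ⟨L, a, hL, ha, hLa⟩ := hl.exists_index hN hne
  obtain ⟨U, b, hU, hb, hUb⟩ := hu.exists_index hN hne
  simp only [hrad] at hne ha hb
  obtain ⟨s₀, hs₀⟩ := exists_pow_lt_of_lt_one hr (show (2⁻¹ : ℝ) < 1 by norm_num)
  have hmono : ∀ {s t : ℕ}, s ≤ t → (2⁻¹ : ℝ) ^ t ≤ 2⁻¹ ^ s := fun h =>
    pow_le_pow_of_le_one (by norm_num) (by norm_num) h
  have hmain : IsComputablePointIn A realPoints H := by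
    refine isComputablePointIn_of_bounds hU hL hUb hLa (s₀ := s₀) (fun s hs => ⟨?_, ?_⟩)
      fun η hη => ?_
    -- With `δ = 2⁻¹ ^ s`: if `rotationVector Φ ν` is within `δ - ε` of `w₀`, its perturbed vector
    -- is within `δ`, hence shared by some `μ` of entropy above `H`, and the two vectors under `Φ`
    -- differ by at most `2ε`. The ball left by convexity has radius `δ - 3ε`, positive since `4ε <
    -- δ`.
    · by_contra! hlt
      have hδr := (hmono hs).trans_lt hs₀
      have hε4 := hNε s
      have hεp := hεpos (N s)
      obtain ⟨μ, hμ, hμw, hlt'⟩ := (hconc Φ).exists_lt_of_perturbation (w := w₀) (v := w₀)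
        (ρ := 2⁻¹ ^ s - ε (N s)) (a := 2 * ε (N s)) (c := H) (by positivity)
        (fun v hv => by
          rw [Metric.mem_ball] at hv
          obtain ⟨ν, hν, rfl⟩ := hball' (Metric.mem_ball.2 (by linarith))
          have h1 := hdist (N s) ν
          rw [dist_comm] at h1
          obtain ⟨μ, hμ, hμv, hc⟩ := exists_lt_measureEntropy_of_minLocalEntropy hfin (hne s)
            (ha s) hlt (v := rotationVector (Ψ (N s)) ν) ⟨by
              rw [Metric.mem_closedBall]
              linarith [dist_triangle (rotationVector (Ψ (N s)) ν) (rotationVector Φ ν) w₀],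
              ν, hν, rfl⟩
          refine ⟨μ, hμ, ?_, hc⟩
          have h2 := hdist (N s) μ
          rw [hμv] at h2
          linarith [dist_triangle (rotationVector Φ μ) (rotationVector (Ψ (N s)) ν)
            (rotationVector Φ ν)])
        (Metric.mem_ball_self (by linarith))
      exact hlt'.not_ge (hH μ hμ hμw)
    · refine le_of_forall_lt fun c hc => ?_
      obtain ⟨μ, hμ, hμw, hcμ⟩ := hH' c hc
      have h1 := hdist (N s) μ
      rw [hμw, dist_comm] at h1
      have h2 := measureEntropy_le_of_maxLocalEntropy (hne s) (hb s) hμ (by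
        rw [Metric.mem_closedBall]
        linarith [hNε s, hεpos (N s)])
      have h3 := (hb s).symm
      rw [maxLocalEntropy, if_pos (hne s)] at h3
      exact hcμ.trans_le
        (ENNReal.toReal_le_of_le_ofReal (eq_ofReal_of_coe_eq_coe h3.symm).1 h2)
    · obtain ⟨ρ₁, hρ₁, h1⟩ := (hconc Φ).exists_forall_le he0 hr hball' hH
        (show 0 < η / 3 by positivity)
      obtain ⟨μ₁, hμ₁, hμ₁w, hμ₁e⟩ := hH' (H - η / 3) (by linarith)
      obtain ⟨ρ₂, hρ₂, h2⟩ := (hconc Φ).exists_forall_exists_lt he0 hr hball' hμ₁ hμ₁w hμ₁e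
      -- The factor 2 leaves room for the perturbation: both bounds below need only that the radius
      -- plus `ε` is less than `ρ₁` and `ρ₂`.
      obtain ⟨t, ht⟩ := exists_pow_lt_of_lt_one (show 0 < min ρ₁ ρ₂ / 2 by positivity)
        (show (2⁻¹ : ℝ) < 1 by norm_num)
      refine ⟨max s₀ t, le_max_left _ _, ?_⟩
      set s := max s₀ t
      have hδ : (2⁻¹ : ℝ) ^ s < min ρ₁ ρ₂ / 2 := (hmono (le_max_right _ _)).trans_lt ht
      have hδ₁ := min_le_left ρ₁ ρ₂
      have hδ₂ := min_le_right ρ₁ ρ₂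
      have hε4 := hNε s
      have hεp := hεpos (N s)
      have hbs : b s ≤ H + η / 3 := le_of_maxLocalEntropy hfin (hne s) (hb s) fun μ hμ hμw =>
        h1 μ hμ (by
          rw [Metric.mem_closedBall] at hμw
          rw [Metric.mem_ball]
          linarith [hdist (N s) μ,
            dist_triangle (rotationVector Φ μ) (rotationVector (Ψ (N s)) μ) w₀])
      have has : H - η / 3 ≤ a s := le_of_minLocalEntropy (hne s) (ha s) fun v hv =>
        (hconc (Ψ (N s))).exists_lt_of_perturbation (w := w₀) (ρ := ρ₂) (a := ε (N s)) hεp.le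
          (fun v hv => by
            obtain ⟨ν, hν, hνv, hc⟩ := h2 v hv
            refine ⟨ν, hν, ?_, hc⟩
            rw [← hνv, dist_comm]
            exact hdist (N s) ν)
          (by
            rw [Metric.mem_closedBall] at hv
            rw [Metric.mem_ball]
            linarith)
      linarith
  refine ⟨htop, hmain, fun hA => ?_⟩
  obtain ⟨φ, hφ, hφH⟩ := hmain
  exact ⟨φ, hφ.computable_of_oracle hA, hφH⟩
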